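/- Let $a,b,c,d,u,v\ge 0$ be real numbers with $a+b+c+d=1$, $u^2\le ad$, $v^2\le bc$, $a+b>0$ and $c+d>0$, and let $\rho^{AB}$ be the two-qubit X state which in the ordered basis $|00\rangle,|01\rangle,|10\rangle,|11\rangle$ is given by $$\rho^{AB}=\begin{pmatrix} a&0&0&u\\0&b&v&0\\0&v&c&0\\u&0&0&d\end{pmatrix}.$$ Put $\ell_1=\frac{u+v}{\sqrt{(a+b)(c+d)}}$, $\ell_3=\frac{|ad-bc|}{(a+b)(c+d)}$, $z_0=\frac{ac-bd}{(a+b)(c+d)}$, and let $\mathbf E=\{(\ell_1\cos t,\;z_0+\ell_3\sin t):t\in\mathbb R\}$ be the steering ellipse in the $x$-$z$ plane (a line segment if a semiaxis vanishes). The reduced state $\rho^B$ has Bloch vector $(0,0,z_B)$ with $z_B=a-b+c-d$. For a finite POVM $M=\{M_i\}$ on $A$ ($M_i\ge0$, $\sum_iM_i=\mathbb 1$) let $p_i=\mathrm{Tr}[(M_i\otimes\mathbb 1)\rho^{AB}]$, $\rho^{B|M_i}=\mathrm{Tr}_A[(M_i\otimes\mathbb 1)\rho^{AB}]/p_i$ and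 $S(\rho^B|M)=\sum_ip_iS(\rho^{B|M_i})$ (outcomes with $p_i=0$ contribute $0$), where $S(\rho)=-\mathrm{Tr}(\rho\log_2\rho)$ is the von Neumann entropy. Call $M$ optimal if $S(\rho^B|M)\le S(\rho^B|N)$ for every finite POVM $N$ on $A$. Assume that the steering ellipse is centered at the origin, that is, $z_0=0$. 1. If $\ell_1>\ell_3$ (oblate ellipse), then the von Neumann measurement of $\sigma_x^A$ (with elements $\frac{1\pm\sigma_x}{2}$) induces the horizontal decomposition of $\rho^B$, that is, its two conditional states have Bloch vectors $(x,0,z_B)$ and $(-x,0,z_B)$ for some real $x$ with $(\pm x,z_B)\in\mathbf E$, and this measurement is optimal. 2. If $\ell_1<\ell_3$ (prolate ellipse), then the von Neumann measurement of $\sigma_z^A$ (with elements $\frac{1\pm\sigma_z}{2}$) induces the vertical decomposition of $\rho^B$, that is, its two conditional states have, in some order, the Bloch vectors $(0,0,z_0+\ell_3)$ and $(0,0,z_0-\ell_3)$, and this measurement is optimal. The marginals $\rho^A$ and $\rho^B$ are not assumed to be maximally mixed. -/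

import Mathlib

open scoped Kronecker ComplexOrder

noncomputable section

namespace TwoQubit

/-- Operators on a single qubit, in the computational basis. -/
abbrev QubitOp := Matrix (Fin 2) (Fin 2) ℂ

/-- Operators on the pair `AB`; the first index belongs to `A`, the second one to `B`. -/
abbrev PairOp := Matrix (Fin 2 × Fin 2) (Fin 2 × Fin 2) ℂ

/-- The Pauli matrix `σ_x`. -/
def pauliX : QubitOp := !![0, 1; 1, 0]

/-- The Pauli matrix `σ_y`. -/
def pauliY : QubitOp := !![0, -Complex.I; Complex.I, 0]

/-- The Pauli matrix `σ_z`. -/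
def pauliZ : QubitOp := !![1, 0; 0, -1]

/-- The Bloch vector `(Tr ρσ_x, Tr ρσ_y, Tr ρσ_z)` of a qubit state. -/
def blochVector (ρ : QubitOp) : Fin 3 → ℝ :=
  ![((ρ * pauliX).trace).re, ((ρ * pauliY).trace).re, ((ρ * pauliZ).trace).re]

/-- The von Neumann entropy `S(ρ) = -Tr (ρ log₂ ρ)`: the sum of `-μ log₂ μ` over the eigenvalues
`μ` of `ρ`, counted with multiplicity. -/
def vonNeumannEntropy (ρ : QubitOp) : ℝ :=
  (ρ.charpoly.roots.map fun μ => Real.negMulLog μ.re / Real.log 2).sum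

/-- The partial trace over `A`. -/
def partialTraceA (X : PairOp) : QubitOp :=
  Matrix.of fun j j' => ∑ i, X (i, j) (i, j')

/-- A (finite) POVM on a qubit: positive semidefinite elements that sum to the identity. -/
structure IsPOVM {n : ℕ} (M : Fin n → QubitOp) : Prop where
  posSemidef : ∀ i, (M i).PosSemidef
  sum_eq_one : ∑ i, M i = 1

/-- The von Neumann measurement of an observable `σ` with `σ² = 1`: the pair of its
spectral projections `(1 + σ) / 2` and `(1 - σ) / 2`. -/
def spinMeasurement (σ : QubitOp) : Fin 2 → QubitOp :=
  ![(1 / 2 : ℂ) • (1 + σ), (1 / 2 : ℂ) • (1 - σ)]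

/-- The unnormalized state of `B` after the outcome `E` of a measurement on `A`:
`Tr_A [(E ⊗ 1) ρ]`. -/
def unnormalizedState (ρ : PairOp) (E : QubitOp) : QubitOp :=
  partialTraceA ((E ⊗ₖ (1 : QubitOp)) * ρ)

/-- The probability `p = Tr [(E ⊗ 1) ρ]` of the outcome `E`. -/
def outcomeProb (ρ : PairOp) (E : QubitOp) : ℝ :=
  (((E ⊗ₖ (1 : QubitOp)) * ρ).trace).re

/-- The conditional state `Tr_A [(E ⊗ 1) ρ] / p` of `B` after the outcome `E`
(the zero matrix if `p = 0`; such outcomes carry weight `0` below). -/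
def conditionalState (ρ : PairOp) (E : QubitOp) : QubitOp :=
  (((outcomeProb ρ E)⁻¹ : ℝ) : ℂ) • unnormalizedState ρ E

/-- The conditional entropy (average entropy) `S(ρ^B | M) = ∑ᵢ pᵢ S(ρ^{B|Mᵢ})`. -/
def conditionalEntropy (ρ : PairOp) {n : ℕ} (M : Fin n → QubitOp) : ℝ :=
  ∑ i, outcomeProb ρ (M i) * vonNeumannEntropy (conditionalState ρ (M i))

/-- A POVM `M` on `A` is optimal for `ρ` if it minimizes the conditional entropy of `B` among
all POVMs on `A`. -/
def IsOptimal (ρ : PairOp) {n : ℕ} (M : Fin n → QubitOp) : Prop :=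
  IsPOVM M ∧
    ∀ (m : ℕ) (N : Fin m → QubitOp), IsPOVM N → conditionalEntropy ρ M ≤ conditionalEntropy ρ N

/-- The X state, in the ordered basis `|00⟩, |01⟩, |10⟩, |11⟩`. -/
def xState (a b c d u v : ℝ) : PairOp :=
  Matrix.reindex finProdFinEquiv.symm finProdFinEquiv.symm
    (!![(a : ℂ), 0, 0, u;
        0, b, v, 0;
        0, v, c, 0;
        u, 0, 0, d] : Matrix (Fin (2 * 2)) (Fin (2 * 2)) ℂ)

/-- The semiaxis `ℓ₁` (in the direction `x`) of the steering ellipsoid of the X state. -/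
def ell1 (a b c d u v : ℝ) : ℝ := (u + v) / √((a + b) * (c + d))

/-- The semiaxis `ℓ₃` (in the direction `z`) of the steering ellipsoid of the X state. -/
def ell3 (a b c d : ℝ) : ℝ := |a * d - b * c| / ((a + b) * (c + d))

/-- The `z`-coordinate of the centre of the steering ellipsoid of the X state. -/
def centerZ (a b c d : ℝ) : ℝ := (a * c - b * d) / ((a + b) * (c + d))

/-- The `z`-coordinate of the point `B = (0, 0, a - b + c - d)` that represents the reduced
state `ρ^B`. -/
def reducedZ (a b c d : ℝ) : ℝ := a - b + c - d

/-- The steering ellipse `x² / ℓ₁² + (z - z₀)² / ℓ₃² = 1` in the `x`-`z` plane, in parametric form,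
so that it is a line segment when a semiaxis vanishes. -/
def steeringEllipse (a b c d u v : ℝ) : Set (ℝ × ℝ) :=
  {P | ∃ t : ℝ, P = (ell1 a b c d u v * Real.cos t, centerZ a b c d + ell3 a b c d * Real.sin t)}

/-- The measurement `M` induces the horizontal decomposition of `ρ^B`: its conditional states are
the end points `(x, z_B)` and `(-x, z_B)` of a chord of the steering ellipse that passes through
`B` and is parallel to the `x` axis. -/
def InducesHorizontal (a b c d u v : ℝ) (M : Fin 2 → QubitOp) : Prop :=
  ∃ x : ℝ,
    (x, reducedZ a b c d) ∈ steeringEllipse a b c d u v ∧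
    (-x, reducedZ a b c d) ∈ steeringEllipse a b c d u v ∧
    blochVector (conditionalState (xState a b c d u v) (M 0)) = ![x, 0, reducedZ a b c d] ∧
    blochVector (conditionalState (xState a b c d u v) (M 1)) = ![-x, 0, reducedZ a b c d]

/-- The measurement `M` induces the vertical decomposition of `ρ^B`: its conditional states are, in
some order, the vertices `(0, z₀ + ℓ₃)` and `(0, z₀ - ℓ₃)` of the steering ellipse on the
`z` axis. -/
def InducesVertical (a b c d u v : ℝ) (M : Fin 2 → QubitOp) : Prop :=
  ∃ i j : Fin 2, i ≠ j ∧
    blochVector (conditionalState (xState a b c d u v) (M i)) =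
      ![0, 0, centerZ a b c d + ell3 a b c d] ∧
    blochVector (conditionalState (xState a b c d u v) (M j)) =
      ![0, 0, centerZ a b c d - ell3 a b c d]

end TwoQubit

end

open scoped Kronecker ComplexOrder

namespace TwoQubit

/-! ### Monotonicity and convexity of the entropy along the ellipse. -/

section BinaryEntropy

open Real Set

/-! Centering means `ac = bd`, so with `p = a + b`, `q = c + d` the diagonal is `ps, p(1 - s), q(1 -
s), qs`. The ellipse then has squared semiaxes `L = (u + v)² / (pq)` and `k² = (2s - 1)²`. An
outcome with diagonal entries `m, n` has probability `P = mp + nq`. Put `w = |mp - nq| / P`, which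
lies in `[0, 1]` when `P > 0`. Positivity of the POVM element bounds the squared Bloch length of the
conditional state by `L - (L - k²) w²`. Entropy decreases with that length, so the outcome
contributes at least `P f(w)`, where `f(w) = radialEntropy (L - (L - k²) w²) / log 2`
(`sum_mul_radialEntropy_le_conditionalEntropy`). The probabilities sum to `1`. In the prolate case
the squared length is at most `k²` for every outcome, and `σ_z` attains this with both of its
outcomes. In the oblate case `f` is increasing and convex on `[0, 1]`
(`radialEntropy_quadratic_convexOn`), while `∑ P w ≥ |p - q|` by the triangle inequality. Jensen
gives the bound `f(|p - q|)`, which `σ_x` attains because both of its outcomes have `w = |p - q|`.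
-/

/-- The entropy, in nats, of a qubit whose Bloch vector has squared length `t`. -/
noncomputable def radialEntropy (t : ℝ) : ℝ := binEntropy ((1 + √t) / 2)

lemma radialEntropy_antitoneOn : AntitoneOn radialEntropy (Iic 1) := by
  intro s hs t ht hst
  have h1 : √s ≤ √t := Real.sqrt_le_sqrt hst
  have h2 : √t ≤ 1 := Real.sqrt_le_one.2 ht
  have h3 := Real.sqrt_nonneg s
  apply Real.binEntropy_strictAntiOn.antitoneOn
  · constructor <;> linarith
  · constructor <;> linarith
  · linarith

lemma radialEntropy_continuous : Continuous radialEntropy := by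
  unfold radialEntropy
  fun_prop

lemma two_mul_le_log_sub_log {r : ℝ} (h0 : 0 ≤ r) (h1 : r < 1) :
    2 * r ≤ log (1 + r) - log (1 - r) := by
  -- This argument makes `1 + x = (1 + r) / (1 - r)` and `2x / (x + 2) = 2r`.
  have h := Real.le_log_one_add_of_nonneg (x := 2 * r / (1 - r))
    (div_nonneg (by linarith) (by linarith))
  have h2 : (1 - r) ≠ 0 := by linarith
  have e1 : 2 * (2 * r / (1 - r)) / (2 * r / (1 - r) + 2) = 2 * r := by
    field_simp
    ring
  have e2 : 1 + 2 * r / (1 - r) = (1 + r) / (1 - r) := by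
    field_simp
    ring
  rw [e1, e2, Real.log_div (by linarith) h2] at h
  exact h

variable {L δ x : ℝ}

lemma hasDerivAt_sqrt_sub_mul_sq (h : 0 < L - δ * x ^ 2) :
    HasDerivAt (fun x => √(L - δ * x ^ 2)) (-(δ * x) / √(L - δ * x ^ 2)) x := by
  have h1 : HasDerivAt (fun x : ℝ => L - δ * x ^ 2) (-(2 * δ * x)) x := by
    have := ((hasDerivAt_pow 2 x).const_mul δ).const_sub L
    refine this.congr_deriv ?_
    norm_num
    ring
  convert h1.sqrt h.ne' using 1
  have := (Real.sqrt_pos.2 h).ne'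
  field_simp

lemma hasDerivAt_radialEntropy_quadratic (h0 : 0 < L - δ * x ^ 2) (h1 : L - δ * x ^ 2 < 1) :
    HasDerivAt (fun x => radialEntropy (L - δ * x ^ 2))
      (δ / 2 * (x * (log (1 + √(L - δ * x ^ 2)) - log (1 - √(L - δ * x ^ 2))) /
        √(L - δ * x ^ 2))) x := by
  have hr := Real.sqrt_pos.2 h0
  have hr1 : √(L - δ * x ^ 2) < 1 := by
    rw [Real.sqrt_lt' one_pos]; simpa using h1
  have h2 := ((hasDerivAt_sqrt_sub_mul_sq h0).const_add 1).div_const 2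
  have h3 := Real.hasDerivAt_binEntropy (p := (1 + √(L - δ * x ^ 2)) / 2)
    (by linarith) (by linarith)
  have h4 := h3.comp x h2
  refine h4.congr_deriv ?_
  rw [show 1 - (1 + √(L - δ * x ^ 2)) / 2 = (1 - √(L - δ * x ^ 2)) / 2 by ring,
    Real.log_div (by linarith) two_ne_zero, Real.log_div (by linarith) two_ne_zero]
  field_simp
  ring

/-- With `r = √(L - δx²)` and `A = log ((1 + r) / (1 - r))`, the derivative is `(A L - 2r (L - r²) /
(1 - r²)) / r³`. It is nonnegative because `A ≥ 2r` and, for `L ≤ 1`, `(L - r²) / (1 - r²) ≤ L`. -/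
lemma hasDerivAt_deriv_radialEntropy_quadratic
    (h0 : 0 < L - δ * x ^ 2) (h1 : L - δ * x ^ 2 < 1) :
    ∃ y, HasDerivAt (fun x => x * (log (1 + √(L - δ * x ^ 2)) - log (1 - √(L - δ * x ^ 2))) /
        √(L - δ * x ^ 2)) y x ∧ (L ≤ 1 → 0 ≤ δ → 0 ≤ y) := by
  have hr := Real.sqrt_pos.2 h0
  have hr1 : √(L - δ * x ^ 2) < 1 := by
    rw [Real.sqrt_lt' one_pos]; simpa using h1
  have hd := hasDerivAt_sqrt_sub_mul_sq h0
  have hp := (hd.const_add 1).log (by linarith)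
  have hm := (hd.const_sub 1).log (by linarith)
  have hsq := Real.sq_sqrt h0.le
  refine ⟨_, ((hasDerivAt_id x).mul (hp.sub hm)).div hd hr.ne', fun hL hδ => ?_⟩
  have hlog := two_mul_le_log_sub_log hr.le hr1
  simp only [id, Pi.mul_apply, Pi.sub_apply]
  set r := √(L - δ * x ^ 2) with hrdef
  set A := log (1 + r) - log (1 - r) with hA
  have hx : δ * x ^ 2 = L - r ^ 2 := by linarith
  have hr2 : 0 < 1 - r ^ 2 := by nlinarith
  have h1r : (1 - r) ≠ 0 := by linarith
  have h2r : (1 + r) ≠ 0 := by linarith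
  -- The numerator from the quotient rule, with `x` eliminated through `δx² = L - r²`.
  have key : (1 * A + x * (-(δ * x) / r / (1 + r) - -(-(δ * x) / r) / (1 - r))) * r -
      x * A * (-(δ * x) / r) = (A * L - 2 * (r * ((L - r ^ 2) / (1 - r ^ 2)))) / r := by
    rw [← hx, show (1 - r ^ 2) = (1 - r) * (1 + r) by ring]
    have : L = δ * x ^ 2 + r ^ 2 := by linarith
    rw [this]
    field_simp
    ring
  rw [key]
  apply div_nonneg _ (sq_nonneg _)
  apply div_nonneg _ hr.le
  have hLr : 0 ≤ L - r ^ 2 := by rw [← hx]; positivity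
  have hq : (L - r ^ 2) / (1 - r ^ 2) ≤ L := by
    rw [div_le_iff₀ hr2]; nlinarith
  have hL0 : 0 ≤ L := by nlinarith
  nlinarith

/-- The second derivative is nonnegative in the interior. There `δ ≤ L ≤ 1` keeps the argument
strictly between `0` and `1`, away from the singularities; continuity covers the end points. -/
lemma radialEntropy_quadratic_convexOn (hL : L ≤ 1) (hδ : 0 < δ) (hδL : δ ≤ L) :
    ConvexOn ℝ (Icc 0 1) (fun x => radialEntropy (L - δ * x ^ 2)) := by
  have bounds : ∀ x ∈ Ioo (0 : ℝ) 1, 0 < L - δ * x ^ 2 ∧ L - δ * x ^ 2 < 1 := by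
    intro x hx
    have h1 : 0 < x ^ 2 := pow_pos hx.1 2
    have h2 : x ^ 2 < 1 := by nlinarith [hx.1, hx.2]
    constructor <;> nlinarith
  have h := fun x hx => hasDerivAt_deriv_radialEntropy_quadratic (bounds x hx).1 (bounds x hx).2
  choose! y hy using h
  apply convexOn_of_hasDerivWithinAt2_nonneg (convex_Icc 0 1)
    (f' := fun x => δ / 2 * (x * (log (1 + √(L - δ * x ^ 2)) - log (1 - √(L - δ * x ^ 2))) /
        √(L - δ * x ^ 2))) (f'' := fun x => δ / 2 * y x)
  · exact (radialEntropy_continuous.comp (by fun_prop)).continuousOn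
  · rw [interior_Icc]
    exact fun x hx => (hasDerivAt_radialEntropy_quadratic (bounds x hx).1
      (bounds x hx).2).hasDerivWithinAt
  · rw [interior_Icc]
    exact fun x hx => ((hy x hx).1.const_mul _).hasDerivWithinAt
  · rw [interior_Icc]
    exact fun x hx => mul_nonneg (by linarith) ((hy x hx).2 hL hδ.le)

end BinaryEntropy

/-! ### Entropy of a qubit, conditional states of X states, and POVM elements. -/

/-- A `2 × 2` matrix of trace `1` has the eigenvalues `(1 ± √t) / 2`, where `det = (1 - t) / 4`. -/
lemma vonNeumannEntropy_eq_radialEntropy {σ : QubitOp} {t : ℝ} (ht : 0 ≤ t)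
    (htr : σ.trace = 1) (hdet : σ.det = ((1 - t) / 4 : ℝ)) :
    vonNeumannEntropy σ = radialEntropy t / Real.log 2 := by
  have hs : (√t : ℂ) ^ 2 = t := by exact_mod_cast Real.sq_sqrt ht
  have hchar : σ.charpoly = (Polynomial.X - Polynomial.C (((1 + √t) / 2 : ℝ) : ℂ)) *
      (Polynomial.X - Polynomial.C ((1 - (1 + √t) / 2 : ℝ) : ℂ)) := by
    rw [Matrix.charpoly_fin_two, htr, hdet]
    have h1 : (1 : ℂ) = (((1 + √t) / 2 : ℝ) : ℂ) + ((1 - (1 + √t) / 2 : ℝ) : ℂ) := by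
      push_cast; ring
    have h2 : (((1 - t) / 4 : ℝ) : ℂ) =
        (((1 + √t) / 2 : ℝ) : ℂ) * ((1 - (1 + √t) / 2 : ℝ) : ℂ) := by
      push_cast
      rw [← hs]
      ring
    rw [h2]
    nth_rw 1 [h1]
    rw [Polynomial.C_add, Polynomial.C_mul]
    ring
  have hne : (Polynomial.X - Polynomial.C (((1 + √t) / 2 : ℝ) : ℂ)) *
      (Polynomial.X - Polynomial.C ((1 - (1 + √t) / 2 : ℝ) : ℂ)) ≠ 0 :=
    mul_ne_zero (Polynomial.X_sub_C_ne_zero _) (Polynomial.X_sub_C_ne_zero _)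
  rw [vonNeumannEntropy, hchar, Polynomial.roots_mul hne, Polynomial.roots_X_sub_C,
    Polynomial.roots_X_sub_C, radialEntropy, Real.binEntropy_eq_negMulLog_add_negMulLog_one_sub]
  simp only [Multiset.map_add, Multiset.map_singleton, Multiset.sum_add, Multiset.sum_singleton,
    Complex.ofReal_re]
  ring

section XState

variable (a b c d u v : ℝ) (E : QubitOp)

lemma unnormalizedState_xState :
    unnormalizedState (xState a b c d u v) E =
      !![E 0 0 * a + E 1 1 * c, E 1 0 * u + E 0 1 * v;
         E 0 1 * u + E 1 0 * v, E 0 0 * b + E 1 1 * d] := by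
  have e00 : finProdFinEquiv ((0 : Fin 2), (0 : Fin 2)) = (0 : Fin (2 * 2)) := rfl
  have e01 : finProdFinEquiv ((0 : Fin 2), (1 : Fin 2)) = (1 : Fin (2 * 2)) := rfl
  have e10 : finProdFinEquiv ((1 : Fin 2), (0 : Fin 2)) = (2 : Fin (2 * 2)) := rfl
  have e11 : finProdFinEquiv ((1 : Fin 2), (1 : Fin 2)) = (3 : Fin (2 * 2)) := rfl
  ext i j
  fin_cases i <;> fin_cases j <;>
    simp [unnormalizedState, partialTraceA, Matrix.mul_apply, xState, Fintype.sum_prod_type,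
      Matrix.one_apply, e00, e01, e10, e11] <;>
    ring

lemma outcomeProb_xState :
    outcomeProb (xState a b c d u v) E = (E 0 0).re * (a + b) + (E 1 1).re * (c + d) := by
  have h : outcomeProb (xState a b c d u v) E =
      ((unnormalizedState (xState a b c d u v) E).trace).re := by
    simp [outcomeProb, unnormalizedState, partialTraceA, Matrix.trace, Fintype.sum_prod_type]
    ring
  rw [h, unnormalizedState_xState]
  simp [Matrix.trace]
  ring

lemma conditionalState_xState :
    conditionalState (xState a b c d u v) E =
      (((E 0 0).re * (a + b) + (E 1 1).re * (c + d) : ℝ)⁻¹ : ℂ) •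
        !![E 0 0 * a + E 1 1 * c, E 1 0 * u + E 0 1 * v;
           E 0 1 * u + E 1 0 * v, E 0 0 * b + E 1 1 * d] := by
  rw [conditionalState, unnormalizedState_xState, outcomeProb_xState, Complex.ofReal_inv]

end XState

/-- A positive semidefinite qubit operator is `!![m, x + iy; x - iy, n]` with real entries
such that `x² + y² ≤ mn`. -/
lemma exists_entries_of_posSemidef {E : QubitOp} (hE : E.PosSemidef) :
    ∃ m n x y : ℝ, 0 ≤ m ∧ 0 ≤ n ∧ x ^ 2 + y ^ 2 ≤ m * n ∧
      E = !![(m : ℂ), ⟨x, y⟩; ⟨x, -y⟩, (n : ℂ)] := by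
  have h0 := Complex.nonneg_iff.1 (hE.diag_nonneg (i := 0))
  have h1 := Complex.nonneg_iff.1 (hE.diag_nonneg (i := 1))
  have h10 := hE.isHermitian.apply 1 0
  have hform : E = !![((E 0 0).re : ℂ), ⟨(E 0 1).re, (E 0 1).im⟩;
      ⟨(E 0 1).re, -(E 0 1).im⟩, ((E 1 1).re : ℂ)] := by
    ext i j
    fin_cases i <;> fin_cases j
    · exact Complex.ext rfl h0.2.symm
    · rfl
    · exact h10.symm
    · exact Complex.ext rfl h1.2.symm
  refine ⟨(E 0 0).re, (E 1 1).re, (E 0 1).re, (E 0 1).im, h0.1, h1.1, ?_, hform⟩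
  have hdet := (Complex.nonneg_iff.1 hE.det_nonneg).1
  rw [hform, Matrix.det_fin_two] at hdet
  simp at hdet
  nlinarith

lemma spinMeasurement_isPOVM {σ : QubitOp} (hσ : σ.IsHermitian) (hsq : σ * σ = 1) :
    IsPOVM (spinMeasurement σ) := by
  have key : ∀ τ : QubitOp, τ.IsHermitian → τ * τ = 1 →
      ((1 / 2 : ℂ) • (1 + τ)).PosSemidef := by
    intro τ hτ hτ2
    have h : (1 / 2 : ℂ) • (1 + τ) =
        Matrix.conjTranspose ((1 / 2 : ℂ) • (1 + τ)) * ((1 / 2 : ℂ) • (1 + τ)) := by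
      rw [Matrix.conjTranspose_smul, Matrix.conjTranspose_add, Matrix.conjTranspose_one, hτ.eq,
        Matrix.smul_mul, Matrix.mul_smul, add_mul, mul_add, mul_add, hτ2, smul_smul]
      simp only [one_mul, mul_one]
      rw [show 1 + τ + (τ + 1) = (2 : ℂ) • (1 + τ) by rw [two_smul]; abel, smul_smul]
      congr 1
      norm_num
    rw [h]
    exact Matrix.posSemidef_conjTranspose_mul_self _
  refine ⟨fun i => ?_, ?_⟩
  · fin_cases i
    · exact key σ hσ hsq
    · have := key (-σ) hσ.neg (by simpa using hsq)
      simpa [spinMeasurement, sub_eq_add_neg] using this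
  · rw [Fin.sum_univ_two]
    simp only [spinMeasurement, Matrix.cons_val_zero, Matrix.cons_val_one]
    rw [← smul_add, show (1 + σ) + (1 - σ) = (2 : ℂ) • (1 : QubitOp) by rw [two_smul]; abel,
      smul_smul]
    norm_num

lemma pauliX_isPOVM : IsPOVM (spinMeasurement pauliX) := by
  apply spinMeasurement_isPOVM
  · ext i j; fin_cases i <;> fin_cases j <;> simp [pauliX]
  · ext i j; fin_cases i <;> fin_cases j <;> simp [pauliX]

lemma pauliZ_isPOVM : IsPOVM (spinMeasurement pauliZ) := by
  apply spinMeasurement_isPOVM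
  · ext i j; fin_cases i <;> fin_cases j <;> simp [pauliZ]
  · ext i j; fin_cases i <;> fin_cases j <;> simp [pauliZ]

/-! ### Lower bounds on the conditional entropy for a centered ellipse. -/

section CenteredXState

variable {p q s u v : ℝ}

/-- The X states with a centered steering ellipse and marginal `diag(p, q)` on `A`. -/
abbrev centeredXState (p q s u v : ℝ) : PairOp :=
  xState (p * s) (p * (1 - s)) (q * (1 - s)) (q * s) u v

lemma outcomeProb_centeredXState (E : QubitOp) :
    outcomeProb (centeredXState p q s u v) E = (E 0 0).re * p + (E 1 1).re * q := by
  rw [outcomeProb_xState]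
  ring

lemma vonNeumannEntropy_conditionalState_centeredXState {m n x y : ℝ}
    (hP : m * p + n * q ≠ 0) :
    vonNeumannEntropy (conditionalState (centeredXState p q s u v)
        !![(m : ℂ), ⟨x, y⟩; ⟨x, -y⟩, (n : ℂ)]) =
      radialEntropy (((2 * s - 1) ^ 2 * (m * p - n * q) ^ 2 +
        4 * ((u + v) ^ 2 * x ^ 2 + (u - v) ^ 2 * y ^ 2)) / (m * p + n * q) ^ 2) / Real.log 2 := by
  have hPC : (m * p + n * q : ℂ) ≠ 0 := by exact_mod_cast hP
  have e1 : (⟨x, y⟩ : ℂ) = x + y * Complex.I := by rw [← Complex.mk_eq_add_mul_I]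
  have e2 : (⟨x, -y⟩ : ℂ) = x - y * Complex.I := by
    rw [Complex.mk_eq_add_mul_I]; push_cast; ring
  have hprob : ((m : ℂ) * (p * s + p * (1 - s)) + n * (q * (1 - s) + q * s)) = m * p + n * q := by
    ring
  apply vonNeumannEntropy_eq_radialEntropy (by positivity)
  · rw [conditionalState_xState, Matrix.trace_smul, Matrix.trace_fin_two]
    simp [hprob]
    field_simp
    ring
  · rw [conditionalState_xState, Matrix.det_smul, Matrix.det_fin_two]
    simp only [e1, e2, Matrix.of_apply, Matrix.cons_val', Matrix.cons_val_zero,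
      Matrix.cons_val_one, Matrix.cons_val_fin_one, Complex.ofReal_re, Fintype.card_fin]
    push_cast
    rw [hprob]
    field_simp
    ring_nf
    rw [Complex.I_sq]
    ring

lemma blochVector_conditionalState_centeredXState (m n x y : ℝ) :
    blochVector (conditionalState (centeredXState p q s u v)
        !![(m : ℂ), ⟨x, y⟩; ⟨x, -y⟩, (n : ℂ)]) =
      ![2 * (u + v) * x / (m * p + n * q), 2 * (u - v) * y / (m * p + n * q),
        (2 * s - 1) * (m * p - n * q) / (m * p + n * q)] := by
  have hprob : (m * (p * s + p * (1 - s)) + n * (q * (1 - s) + q * s)) = m * p + n * q := by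
    ring
  rw [conditionalState_xState]
  simp only [Matrix.of_apply, Matrix.cons_val', Matrix.cons_val_zero,
      Matrix.cons_val_one, Matrix.cons_val_fin_one, Complex.ofReal_re]
  rw [hprob, ← Complex.ofReal_inv]
  simp only [div_eq_mul_inv]
  generalize (m * p + n * q)⁻¹ = r
  ext i
  fin_cases i <;>
    simp [blochVector, pauliX, pauliY, pauliZ, Matrix.trace_fin_two] <;>
    ring

/-- Since `(u - v)² ≤ (u + v)²` and `x² + y² ≤ mn`, the transverse part of the squared Bloch length
is at most `4(u + v)² mn / P²`. The identity `4mnpq = P² - (mp - nq)²` turns this into `L (1 - w²)`.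
-/
lemma radialEntropy_le_vonNeumannEntropy_conditionalState (hp : 0 < p) (hq : 0 < q)
    (hu : 0 ≤ u) (hv : 0 ≤ v) (hL : (u + v) ^ 2 / (p * q) ≤ 1) (hk : (2 * s - 1) ^ 2 ≤ 1)
    {E : QubitOp} (hE : E.PosSemidef) (hP : 0 < (E 0 0).re * p + (E 1 1).re * q) :
    radialEntropy ((u + v) ^ 2 / (p * q) - ((u + v) ^ 2 / (p * q) - (2 * s - 1) ^ 2) *
        (|(E 0 0).re * p - (E 1 1).re * q| / ((E 0 0).re * p + (E 1 1).re * q)) ^ 2) / Real.log 2 ≤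
      vonNeumannEntropy (conditionalState (centeredXState p q s u v) E) := by
  obtain ⟨m, n, x, y, hm, hn, hxy, rfl⟩ := exists_entries_of_posSemidef hE
  simp only [Matrix.of_apply, Matrix.cons_val', Matrix.cons_val_zero,
      Matrix.cons_val_one, Matrix.cons_val_fin_one, Complex.ofReal_re] at hP ⊢
  rw [vonNeumannEntropy_conditionalState_centeredXState hP.ne']
  refine div_le_div_of_nonneg_right ?_ (Real.log_nonneg one_le_two)
  have hpq : 0 < p * q := mul_pos hp hq
  have hP2 : 0 < (m * p + n * q) ^ 2 := by positivity
  rw [div_pow, sq_abs]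
  set L := (u + v) ^ 2 / (p * q) with hLdef
  have hLuv : (u + v) ^ 2 = L * (p * q) := by rw [hLdef]; field_simp
  have hbound : ((2 * s - 1) ^ 2 * (m * p - n * q) ^ 2 +
        4 * ((u + v) ^ 2 * x ^ 2 + (u - v) ^ 2 * y ^ 2)) / (m * p + n * q) ^ 2 ≤
      L - (L - (2 * s - 1) ^ 2) * ((m * p - n * q) ^ 2 / (m * p + n * q) ^ 2) := by
    rw [div_le_iff₀ hP2]
    have e : (L - (L - (2 * s - 1) ^ 2) * ((m * p - n * q) ^ 2 / (m * p + n * q) ^ 2)) *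
        (m * p + n * q) ^ 2 = 4 * ((L * (p * q)) * (m * n)) +
          (2 * s - 1) ^ 2 * (m * p - n * q) ^ 2 := by
      field_simp
      ring
    rw [e, ← hLuv]
    have h1 : (u - v) ^ 2 * y ^ 2 ≤ (u + v) ^ 2 * y ^ 2 :=
      mul_le_mul_of_nonneg_right (by nlinarith) (sq_nonneg y)
    have h2 := mul_le_mul_of_nonneg_left hxy (sq_nonneg (u + v))
    linarith
  -- A convex combination of `L` and `(2s - 1)²`, both at most `1`.
  have hle : L - (L - (2 * s - 1) ^ 2) * ((m * p - n * q) ^ 2 / (m * p + n * q) ^ 2) ≤ 1 := by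
    have h0 : 0 ≤ (m * p - n * q) ^ 2 / (m * p + n * q) ^ 2 := by positivity
    have h1 : (m * p - n * q) ^ 2 / (m * p + n * q) ^ 2 ≤ 1 := by
      rw [div_le_one hP2]
      have : 0 ≤ m * n * (p * q) := by positivity
      nlinarith
    nlinarith
  exact radialEntropy_antitoneOn (hbound.trans hle) hle hbound

lemma re_diag_nonneg {E : QubitOp} (hE : E.PosSemidef) (i : Fin 2) : 0 ≤ (E i i).re :=
  (Complex.nonneg_iff.1 hE.diag_nonneg).1

lemma sum_re_diag {n : ℕ} {N : Fin n → QubitOp} (hN : IsPOVM N) (i : Fin 2) :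
    ∑ k, (N k i i).re = 1 := by
  have h := congrArg (fun X : QubitOp => (X i i).re) hN.sum_eq_one
  simpa [Matrix.sum_apply] using h

lemma sum_outcomeProb_centeredXState (hpq : p + q = 1) {n : ℕ} {N : Fin n → QubitOp}
    (hN : IsPOVM N) : ∑ i, ((N i 0 0).re * p + (N i 1 1).re * q) = 1 := by
  rw [Finset.sum_add_distrib, ← Finset.sum_mul, ← Finset.sum_mul, sum_re_diag hN, sum_re_diag hN]
  linarith

lemma sum_mul_radialEntropy_le_conditionalEntropy (hp : 0 < p) (hq : 0 < q)
    (hu : 0 ≤ u) (hv : 0 ≤ v) (hL : (u + v) ^ 2 / (p * q) ≤ 1) (hk : (2 * s - 1) ^ 2 ≤ 1)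
    {n : ℕ} {N : Fin n → QubitOp} (hN : IsPOVM N) :
    ∑ i, ((N i 0 0).re * p + (N i 1 1).re * q) *
      (radialEntropy ((u + v) ^ 2 / (p * q) - ((u + v) ^ 2 / (p * q) - (2 * s - 1) ^ 2) *
        (|(N i 0 0).re * p - (N i 1 1).re * q| /
          ((N i 0 0).re * p + (N i 1 1).re * q)) ^ 2) / Real.log 2) ≤
      conditionalEntropy (centeredXState p q s u v) N := by
  refine Finset.sum_le_sum fun i _ => ?_
  rw [outcomeProb_centeredXState]
  have h0 := re_diag_nonneg (hN.posSemidef i) 0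
  have h1 := re_diag_nonneg (hN.posSemidef i) 1
  have hP : 0 ≤ (N i 0 0).re * p + (N i 1 1).re * q := by positivity
  rcases hP.eq_or_lt with h | h
  · rw [← h, zero_mul, zero_mul]
  · exact mul_le_mul_of_nonneg_left (radialEntropy_le_vonNeumannEntropy_conditionalState
      hp hq hu hv hL hk (hN.posSemidef i) h) hP

lemma abs_sub_div_add_mem_Icc {x y : ℝ} (hx : 0 ≤ x) (hy : 0 ≤ y) :
    |x - y| / (x + y) ∈ Set.Icc (0 : ℝ) 1 :=
  ⟨by positivity, div_le_one_of_le₀ (abs_le.2 ⟨by linarith, by linarith⟩) (by positivity)⟩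

/-- No convexity is needed: as `w² ≤ 1`, each outcome separately obeys the bound, which is then
averaged. -/
lemma radialEntropy_le_conditionalEntropy_of_prolate (hp : 0 < p) (hq : 0 < q) (hpq : p + q = 1)
    (hu : 0 ≤ u) (hv : 0 ≤ v) (hk : (2 * s - 1) ^ 2 ≤ 1)
    (hlt : (u + v) ^ 2 / (p * q) < (2 * s - 1) ^ 2)
    {n : ℕ} {N : Fin n → QubitOp} (hN : IsPOVM N) :
    radialEntropy ((2 * s - 1) ^ 2) / Real.log 2 ≤
      conditionalEntropy (centeredXState p q s u v) N := by
  refine le_trans ?_ (sum_mul_radialEntropy_le_conditionalEntropy hp hq hu hv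
    (hlt.le.trans hk) hk hN)
  refine le_of_eq_of_le (one_mul (radialEntropy ((2 * s - 1) ^ 2) / Real.log 2)).symm ?_
  refine le_of_eq_of_le (congrArg (· * _) (sum_outcomeProb_centeredXState hpq hN).symm) ?_
  rw [Finset.sum_mul]
  refine Finset.sum_le_sum fun i _ => ?_
  have h0 := re_diag_nonneg (hN.posSemidef i) 0
  have h1 := re_diag_nonneg (hN.posSemidef i) 1
  refine mul_le_mul_of_nonneg_left ?_ (by positivity)
  refine div_le_div_of_nonneg_right ?_ (Real.log_nonneg one_le_two)
  have hx := abs_sub_div_add_mem_Icc (mul_nonneg h0 hp.le) (mul_nonneg h1 hq.le)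
  have hx2 := pow_le_one₀ (n := 2) hx.1 hx.2
  have hle : (u + v) ^ 2 / (p * q) - ((u + v) ^ 2 / (p * q) - (2 * s - 1) ^ 2) *
        (|(N i 0 0).re * p - (N i 1 1).re * q| /
          ((N i 0 0).re * p + (N i 1 1).re * q)) ^ 2 ≤ (2 * s - 1) ^ 2 := by
    nlinarith
  exact radialEntropy_antitoneOn (hle.trans hk) hk hle

/-- Jensen in `w` with the outcome probabilities as weights, then monotonicity in the mean of `w`,
which is at least `|p - q|`. -/
lemma radialEntropy_le_conditionalEntropy_of_oblate (hp : 0 < p) (hq : 0 < q) (hpq : p + q = 1)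
    (hu : 0 ≤ u) (hv : 0 ≤ v) (hL : (u + v) ^ 2 / (p * q) ≤ 1)
    (hlt : (2 * s - 1) ^ 2 < (u + v) ^ 2 / (p * q))
    {n : ℕ} {N : Fin n → QubitOp} (hN : IsPOVM N) :
    radialEntropy ((u + v) ^ 2 / (p * q) - ((u + v) ^ 2 / (p * q) - (2 * s - 1) ^ 2) *
        (p - q) ^ 2) / Real.log 2 ≤
      conditionalEntropy (centeredXState p q s u v) N := by
  refine le_trans ?_ (sum_mul_radialEntropy_le_conditionalEntropy hp hq hu hv
    hL (hlt.le.trans hL) hN)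
  set L := (u + v) ^ 2 / (p * q)
  set δ := L - (2 * s - 1) ^ 2
  have h0 := fun i => mul_nonneg (re_diag_nonneg (hN.posSemidef i) 0) hp.le
  have h1 := fun i => mul_nonneg (re_diag_nonneg (hN.posSemidef i) 1) hq.le
  simp_rw [← mul_div_assoc]
  rw [← Finset.sum_div]
  refine div_le_div_of_nonneg_right ?_ (Real.log_nonneg one_le_two)
  have hconv := radialEntropy_quadratic_convexOn (δ := δ) hL (sub_pos.2 hlt)
    (sub_le_self _ (sq_nonneg _))
  refine le_trans ?_ (hconv.map_sum_le (t := Finset.univ)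
    (fun i _ => add_nonneg (h0 i) (h1 i)) (sum_outcomeProb_centeredXState hpq hN)
    (fun i _ => abs_sub_div_add_mem_Icc (h0 i) (h1 i)))
  -- For an outcome of probability `0`, both nonnegative summands vanish, so the cancellation
  -- survives division by zero.
  have hterm : ∀ i, ((N i 0 0).re * p + (N i 1 1).re * q) • (|(N i 0 0).re * p -
      (N i 1 1).re * q| / ((N i 0 0).re * p + (N i 1 1).re * q)) =
      |(N i 0 0).re * p - (N i 1 1).re * q| := by
    intro i
    rcases (add_nonneg (h0 i) (h1 i)).eq_or_lt with h | h
    · have e0 : (N i 0 0).re * p = 0 := by linarith [h0 i, h1 i]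
      have e1 : (N i 1 1).re * q = 0 := by linarith [h0 i, h1 i]
      simp [e0, e1]
    · rw [smul_eq_mul, mul_div_cancel₀ _ h.ne']
  simp_rw [hterm]
  have hsum : |p - q| ≤ ∑ i, |(N i 0 0).re * p - (N i 1 1).re * q| := by
    refine le_trans (le_of_eq ?_) (Finset.abs_sum_le_sum_abs _ _)
    rw [Finset.sum_sub_distrib, ← Finset.sum_mul, ← Finset.sum_mul, sum_re_diag hN,
      sum_re_diag hN, one_mul, one_mul]
  have hsq : (p - q) ^ 2 ≤ (∑ i, |(N i 0 0).re * p - (N i 1 1).re * q|) ^ 2 := by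
    rw [← sq_abs (p - q)]
    exact pow_le_pow_left₀ (abs_nonneg _) hsum 2
  have hδ : 0 < δ := sub_pos.2 hlt
  refine radialEntropy_antitoneOn ?_ ?_ ?_
  · exact (sub_le_self _ (by positivity)).trans hL
  · exact (sub_le_self _ (by positivity)).trans hL
  · linarith [mul_le_mul_of_nonneg_left hsq hδ.le]

/-! ### The two spin measurements: entropies attained and decompositions induced. -/

lemma spinMeasurement_pauliX_zero : spinMeasurement pauliX 0 =
    !![((1 / 2 : ℝ) : ℂ), ⟨1 / 2, 0⟩; ⟨1 / 2, -0⟩, ((1 / 2 : ℝ) : ℂ)] := by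
  ext i j
  fin_cases i <;> fin_cases j <;> simp [spinMeasurement, pauliX, Complex.ext_iff]

lemma spinMeasurement_pauliX_one : spinMeasurement pauliX 1 =
    !![((1 / 2 : ℝ) : ℂ), ⟨-(1 / 2), 0⟩; ⟨-(1 / 2), -0⟩, ((1 / 2 : ℝ) : ℂ)] := by
  ext i j
  fin_cases i <;> fin_cases j <;> simp [spinMeasurement, pauliX, Complex.ext_iff]

lemma spinMeasurement_pauliZ_zero : spinMeasurement pauliZ 0 =
    !![((1 : ℝ) : ℂ), ⟨0, 0⟩; ⟨0, -0⟩, ((0 : ℝ) : ℂ)] := by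
  ext i j
  fin_cases i <;> fin_cases j <;> norm_num [spinMeasurement, pauliZ, Complex.ext_iff]

lemma spinMeasurement_pauliZ_one : spinMeasurement pauliZ 1 =
    !![((0 : ℝ) : ℂ), ⟨0, 0⟩; ⟨0, -0⟩, ((1 : ℝ) : ℂ)] := by
  ext i j
  fin_cases i <;> fin_cases j <;> norm_num [spinMeasurement, pauliZ, Complex.ext_iff]

lemma conditionalEntropy_pauliX (hp : 0 < p) (hq : 0 < q) (hpq : p + q = 1) :
    conditionalEntropy (centeredXState p q s u v) (spinMeasurement pauliX) =
      radialEntropy ((u + v) ^ 2 / (p * q) - ((u + v) ^ 2 / (p * q) - (2 * s - 1) ^ 2) *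
        (p - q) ^ 2) / Real.log 2 := by
  have hne : 1 / 2 * p + 1 / 2 * q ≠ 0 := by positivity
  rw [conditionalEntropy, Fin.sum_univ_two, spinMeasurement_pauliX_zero,
    spinMeasurement_pauliX_one, outcomeProb_centeredXState, outcomeProb_centeredXState,
    vonNeumannEntropy_conditionalState_centeredXState hne,
    vonNeumannEntropy_conditionalState_centeredXState hne]
  have e : (u + v) ^ 2 / (p * q) - ((u + v) ^ 2 / (p * q) - (2 * s - 1) ^ 2) * (p - q) ^ 2 =
      4 * (u + v) ^ 2 + (2 * s - 1) ^ 2 * (p - q) ^ 2 := by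
    obtain rfl : q = 1 - p := by linarith
    field_simp
    ring
  have hhalf : 1 / 2 * p + 1 / 2 * q = 1 / 2 := by linarith
  rw [e, hhalf]
  have e1 : ((2 * s - 1) ^ 2 * (1 / 2 * p - 1 / 2 * q) ^ 2 +
      4 * ((u + v) ^ 2 * (1 / 2) ^ 2 + (u - v) ^ 2 * 0 ^ 2)) / (1 / 2) ^ 2 =
      4 * (u + v) ^ 2 + (2 * s - 1) ^ 2 * (p - q) ^ 2 := by ring
  have e2 : ((2 * s - 1) ^ 2 * (1 / 2 * p - 1 / 2 * q) ^ 2 +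
      4 * ((u + v) ^ 2 * (-(1 / 2)) ^ 2 + (u - v) ^ 2 * 0 ^ 2)) / (1 / 2) ^ 2 =
      4 * (u + v) ^ 2 + (2 * s - 1) ^ 2 * (p - q) ^ 2 := by ring
  rw [e1, e2]
  simp only [Matrix.of_apply, Matrix.cons_val', Matrix.cons_val_zero,
      Matrix.cons_val_one, Matrix.cons_val_fin_one, Complex.ofReal_re]
  rw [hhalf]
  ring

lemma conditionalEntropy_pauliZ (hp : 0 < p) (hq : 0 < q) (hpq : p + q = 1) :
    conditionalEntropy (centeredXState p q s u v) (spinMeasurement pauliZ) =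
      radialEntropy ((2 * s - 1) ^ 2) / Real.log 2 := by
  rw [conditionalEntropy, Fin.sum_univ_two, spinMeasurement_pauliZ_zero,
    spinMeasurement_pauliZ_one, outcomeProb_centeredXState, outcomeProb_centeredXState,
    vonNeumannEntropy_conditionalState_centeredXState (by simpa using hp.ne'),
    vonNeumannEntropy_conditionalState_centeredXState (by simpa using hq.ne')]
  have e1 : ((2 * s - 1) ^ 2 * (1 * p - 0 * q) ^ 2 +
      4 * ((u + v) ^ 2 * 0 ^ 2 + (u - v) ^ 2 * 0 ^ 2)) / (1 * p + 0 * q) ^ 2 =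
      (2 * s - 1) ^ 2 := by
    field_simp
    ring
  have e2 : ((2 * s - 1) ^ 2 * (0 * p - 1 * q) ^ 2 +
      4 * ((u + v) ^ 2 * 0 ^ 2 + (u - v) ^ 2 * 0 ^ 2)) / (0 * p + 1 * q) ^ 2 =
      (2 * s - 1) ^ 2 := by
    field_simp
    ring
  rw [e1, e2]
  simp only [Matrix.of_apply, Matrix.cons_val', Matrix.cons_val_zero,
      Matrix.cons_val_one, Matrix.cons_val_fin_one, Complex.ofReal_re]
  rw [← add_mul, show 1 * p + 0 * q + (0 * p + 1 * q) = 1 by linarith, one_mul]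

lemma ell1_centered (p q s u v : ℝ) :
    ell1 (p * s) (p * (1 - s)) (q * (1 - s)) (q * s) u v = (u + v) / √(p * q) := by
  rw [ell1]
  congr 2
  ring

lemma ell3_centered (hp : 0 < p) (hq : 0 < q) (s : ℝ) :
    ell3 (p * s) (p * (1 - s)) (q * (1 - s)) (q * s) = |2 * s - 1| := by
  rw [ell3, show p * s * (q * s) - p * (1 - s) * (q * (1 - s)) = p * q * (2 * s - 1) by ring,
    show (p * s + p * (1 - s)) * (q * (1 - s) + q * s) = p * q by ring, abs_mul,
    abs_of_pos (mul_pos hp hq)]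
  field_simp

lemma centerZ_centered (p q s : ℝ) :
    centerZ (p * s) (p * (1 - s)) (q * (1 - s)) (q * s) = 0 := by
  rw [centerZ]
  ring

lemma inducesHorizontal_pauliX (hp : 0 < p) (hq : 0 < q) (hpq : p + q = 1) :
    InducesHorizontal (p * s) (p * (1 - s)) (q * (1 - s)) (q * s) u v
      (spinMeasurement pauliX) := by
  have hz : reducedZ (p * s) (p * (1 - s)) (q * (1 - s)) (q * s) = (2 * s - 1) * (p - q) := by
    rw [reducedZ]; ring
  have hmem : ∀ ε : ℝ, ε ^ 2 = 1 → (ε * (2 * (u + v)), (2 * s - 1) * (p - q)) ∈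
      steeringEllipse (p * s) (p * (1 - s)) (q * (1 - s)) (q * s) u v := by
    intro ε hε
    -- `τ` is the sign of `2s - 1`, taken to be `1` at zero so that `τ² = 1` even for a degenerate
    -- ellipse.
    obtain ⟨τ, hτ, hτ2⟩ : ∃ τ : ℝ, |2 * s - 1| * τ = 2 * s - 1 ∧ τ ^ 2 = 1 := by
      rcases abs_cases (2 * s - 1) with h | h
      · exact ⟨1, by rw [h.1]; ring, by norm_num⟩
      · exact ⟨-1, by rw [h.1]; ring, by norm_num⟩
    have hs := Real.sq_sqrt (mul_pos hp hq).le
    have hs0 := Real.sqrt_pos.2 (mul_pos hp hq)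
    -- The ellipse parameter has `cos t = 2ε√(pq)` and `sin t = τ(p - q)`; this is a unit vector
    -- because `4pq + (p - q)² = (p + q)² = 1`.
    have hnorm : ‖(⟨ε * (2 * √(p * q)), τ * (p - q)⟩ : ℂ)‖ = 1 := by
      rw [← pow_eq_one_iff_of_nonneg (norm_nonneg _) two_ne_zero, Complex.sq_norm,
        Complex.normSq_mk]
      obtain rfl : q = 1 - p := by linarith
      linear_combination (4 * √(p * (1 - p)) ^ 2) * hε + 4 * hs + (p - (1 - p)) ^ 2 * hτ2
    refine ⟨Complex.arg ⟨ε * (2 * √(p * q)), τ * (p - q)⟩, ?_⟩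
    rw [ell1_centered, ell3_centered hp hq, centerZ_centered, Complex.sin_arg,
      Complex.cos_arg (norm_ne_zero_iff.1 (hnorm ▸ one_ne_zero)), hnorm]
    refine Prod.ext ?_ ?_
    · field_simp
    · linear_combination (-(p - q)) * hτ
  have hP : 1 / 2 * p + 1 / 2 * q = 1 / 2 := by linarith
  refine ⟨2 * (u + v), ?_, ?_, ?_, ?_⟩
  · rw [hz]
    simpa using hmem 1 (by norm_num)
  · rw [hz]
    simpa using hmem (-1) (by norm_num)
  · rw [spinMeasurement_pauliX_zero, blochVector_conditionalState_centeredXState, hz, hP]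
    ext i
    fin_cases i <;>
      simp <;>
      ring
  · rw [spinMeasurement_pauliX_one, blochVector_conditionalState_centeredXState, hz, hP]
    ext i
    fin_cases i <;>
      simp <;>
      ring

lemma inducesVertical_pauliZ (hp : 0 < p) (hq : 0 < q) :
    InducesVertical (p * s) (p * (1 - s)) (q * (1 - s)) (q * s) u v
      (spinMeasurement pauliZ) := by
  have h0 : blochVector (conditionalState (centeredXState p q s u v)
      (spinMeasurement pauliZ 0)) = ![0, 0, 2 * s - 1] := by
    rw [spinMeasurement_pauliZ_zero, blochVector_conditionalState_centeredXState]
    ext i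
    fin_cases i <;> simp
    field_simp
  have h1 : blochVector (conditionalState (centeredXState p q s u v)
      (spinMeasurement pauliZ 1)) = ![0, 0, -(2 * s - 1)] := by
    rw [spinMeasurement_pauliZ_one, blochVector_conditionalState_centeredXState]
    ext i
    fin_cases i <;> simp
    field_simp
    ring
  rw [InducesVertical, ell3_centered hp hq, centerZ_centered, zero_add, zero_sub]
  -- The sign of `2s - 1` decides which outcome gives the upper vertex.
  rcases abs_cases (2 * s - 1) with h | h
  · exact ⟨0, 1, by decide, by rw [h0, h.1], by rw [h1, h.1]⟩
  · exact ⟨1, 0, by decide, by rw [h1, h.1], by rw [h0, h.1, neg_neg]⟩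

end CenteredXState

/-! ### Reduction to the parameters `p, q, s`, and the theorem. -/

/-- An X state with a centered steering ellipse is determined by its marginal on `A` and
one further parameter `s ∈ [0, 1]`. -/
lemma exists_parameter_of_centerZ_eq_zero {a b c d : ℝ} (ha : 0 ≤ a) (hb : 0 ≤ b)
    (hab : 0 < a + b) (hcd : 0 < c + d) (hcenter : centerZ a b c d = 0) :
    ∃ s, 0 ≤ s ∧ s ≤ 1 ∧ a = (a + b) * s ∧ b = (a + b) * (1 - s) ∧
      c = (c + d) * (1 - s) ∧ d = (c + d) * s := by
  have hac : a * c = b * d := by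
    rw [centerZ, div_eq_zero_iff] at hcenter
    rcases hcenter with h | h
    · linarith
    · exact absurd h (mul_pos hab hcd).ne'
  refine ⟨a / (a + b), by positivity, div_le_one_of_le₀ (by linarith) hab.le, ?_, ?_, ?_, ?_⟩
  · field_simp
  · field_simp
    ring
  · field_simp
    linarith
  · field_simp
    linarith

/-- Positivity of the state gives `u ≤ s√(pq)` and `v ≤ (1 - s)√(pq)`, which add up to `u + v ≤
√(pq)`: the horizontal semiaxis fits in the Bloch ball. -/
lemma sq_add_div_le_one {p q s u v : ℝ} (hp : 0 < p) (hq : 0 < q) (hs0 : 0 ≤ s) (hs1 : s ≤ 1)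
    (hu : 0 ≤ u) (hv : 0 ≤ v)
    (hu2 : u ^ 2 ≤ p * s * (q * s)) (hv2 : v ^ 2 ≤ p * (1 - s) * (q * (1 - s))) :
    (u + v) ^ 2 / (p * q) ≤ 1 := by
  have hpq := mul_pos hp hq
  have hr := Real.sq_sqrt hpq.le
  have hr0 := Real.sqrt_nonneg (p * q)
  have h1 : u ≤ s * √(p * q) :=
    abs_le_of_sq_le_sq' (by rw [mul_pow, hr]; linarith) (by positivity) |>.2
  have h2 : v ≤ (1 - s) * √(p * q) :=
    abs_le_of_sq_le_sq' (by rw [mul_pow, hr]; linarith)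
      (mul_nonneg (by linarith) hr0) |>.2
  rw [div_le_one hpq, ← hr]
  exact pow_le_pow_left₀ (by positivity) (by linarith) 2

/-- Optimal measurements for a centered steering ellipse: `σ_x` in the oblate case and `σ_z` in the
prolate case. -/
theorem centeredXState_optimal {p q s u v : ℝ} (hp : 0 < p) (hq : 0 < q) (hpq : p + q = 1)
    (hs0 : 0 ≤ s) (hs1 : s ≤ 1) (hu : 0 ≤ u) (hv : 0 ≤ v)
    (hu2 : u ^ 2 ≤ p * s * (q * s)) (hv2 : v ^ 2 ≤ p * (1 - s) * (q * (1 - s))) :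
    (ell3 (p * s) (p * (1 - s)) (q * (1 - s)) (q * s) <
        ell1 (p * s) (p * (1 - s)) (q * (1 - s)) (q * s) u v →
      InducesHorizontal (p * s) (p * (1 - s)) (q * (1 - s)) (q * s) u v
        (spinMeasurement pauliX) ∧
      IsOptimal (centeredXState p q s u v) (spinMeasurement pauliX)) ∧
    (ell1 (p * s) (p * (1 - s)) (q * (1 - s)) (q * s) u v <
        ell3 (p * s) (p * (1 - s)) (q * (1 - s)) (q * s) →
      InducesVertical (p * s) (p * (1 - s)) (q * (1 - s)) (q * s) u v (spinMeasurement pauliZ) ∧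
      IsOptimal (centeredXState p q s u v) (spinMeasurement pauliZ)) := by
  have hL := sq_add_div_le_one hp hq hs0 hs1 hu hv hu2 hv2
  have hk : (2 * s - 1) ^ 2 ≤ 1 := by nlinarith
  have hl1 : ((u + v) / √(p * q)) ^ 2 = (u + v) ^ 2 / (p * q) := by
    rw [div_pow, Real.sq_sqrt (mul_pos hp hq).le]
  rw [ell1_centered, ell3_centered hp hq]
  refine ⟨fun h => ⟨inducesHorizontal_pauliX hp hq hpq, pauliX_isPOVM, fun m N hN => ?_⟩,
    fun h => ⟨inducesVertical_pauliZ hp hq, pauliZ_isPOVM, fun m N hN => ?_⟩⟩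
  · rw [conditionalEntropy_pauliX hp hq hpq]
    refine radialEntropy_le_conditionalEntropy_of_oblate hp hq hpq hu hv hL ?_ hN
    rw [← hl1, ← sq_abs]
    exact pow_lt_pow_left₀ h (abs_nonneg _) two_ne_zero
  · rw [conditionalEntropy_pauliZ hp hq hpq]
    refine radialEntropy_le_conditionalEntropy_of_prolate hp hq hpq hu hv hk ?_ hN
    rw [← hl1, ← sq_abs (2 * s - 1)]
    exact pow_lt_pow_left₀ h (by positivity) two_ne_zero

end TwoQubit

theorem corollary2 (a b c d u v : ℝ)
    (ha : 0 ≤ a) (hb : 0 ≤ b) (hc : 0 ≤ c) (hd : 0 ≤ d) (htr : a + b + c + d = 1)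
    (hu : 0 ≤ u) (hv : 0 ≤ v) (hu2 : u ^ 2 ≤ a * d) (hv2 : v ^ 2 ≤ b * c)
    (hab : 0 < a + b) (hcd : 0 < c + d)
    (hcenter : TwoQubit.centerZ a b c d = 0) :
    (TwoQubit.ell3 a b c d < TwoQubit.ell1 a b c d u v →
      TwoQubit.InducesHorizontal a b c d u v (TwoQubit.spinMeasurement TwoQubit.pauliX) ∧
      TwoQubit.IsOptimal (TwoQubit.xState a b c d u v)
        (TwoQubit.spinMeasurement TwoQubit.pauliX)) ∧
    (TwoQubit.ell1 a b c d u v < TwoQubit.ell3 a b c d →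
      TwoQubit.InducesVertical a b c d u v (TwoQubit.spinMeasurement TwoQubit.pauliZ) ∧
      TwoQubit.IsOptimal (TwoQubit.xState a b c d u v)
        (TwoQubit.spinMeasurement TwoQubit.pauliZ)) := by
  obtain ⟨s, hs0, hs1, ea, eb, ec, ed⟩ :=
    TwoQubit.exists_parameter_of_centerZ_eq_zero ha hb hab hcd hcenter
  have hpq : (a + b) + (c + d) = 1 := by linarith
  -- Once the marginals are independent variables, the equations for `a, b, c, d` are no longer
  -- circular and can be substituted.
  generalize a + b = p at *
  generalize c + d = q at *
  subst ea eb ec ed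
  exact TwoQubit.centeredXState_optimal hab hcd hpq hs0 hs1 hu hv hu2 hv2
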